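/- Let $\lambda>0$, $\theta\in[0,1]$, let $\sigma:\mathbb R\to\mathbb R$ be globally Lipschitz with $J_0:=\inf_{x\ne 0}|\sigma(x)/x|>0$, and let $u_0\equiv I_0>0$ on $[0,1]$. Let $W$ be a space-time white noise on $[0,\infty)\times[0,1]$ with Brownian sheet $W(t,x)=W([0,t]\times[0,x])$. For an integer $n\ge 3$ and $0<\tau<1$ put $t_i=i\tau$, $x_j=j/n$, $\kappa_n(x)=\lfloor nx\rfloor/n$, and let $u^{n,\tau}$ be the solution of the fully discrete ($\theta$-)scheme with periodic boundary condition for $\partial_t u=\partial_x^2u+\lambda\sigma(u)\dot W$: for $i\ge 0$ and $0\le j\le n-1$, $$u^{n,\tau}(t_{i+1},x_j)=u^{n,\tau}(t_i,x_j)+(1-\theta)\tau\Delta_nu^{n,\tau}(t_i,\cdot)(x_j)+\theta\tau\Delta_nu^{n,\tau}(t_{i+1},\cdot)(x_j)+\lambda\tau\sigma(u^{n,\tau}(t_i,x_j))\,\square_{n,\tau}W(t_i,x_j),$$ $u^{n,\tau}(0,x_j)=u_0(x_j)$, where $\Delta_nv(x_j)=n^2(v(x_{j+1})-2v(x_j)+v(x_{j-1}))$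 with indices modulo $n$, and $$\square_{n,\tau}W(t_i,x_j)=n\tau^{-1}\big(W(t_{i+1},x_{j+1})-W(t_i,x_{j+1})-W(t_{i+1},x_j)+W(t_i,x_j)\big);$$ extend $u^{n,\tau}(t_i,\cdot)$ to $[0,1]$ by linear interpolation. Let $\zeta>0$ and assume $n\ge\zeta\lambda^2$ and $$\frac{J_0^4n^2\tau}{16\pi\zeta^2}+16\pi n^2\tau<1 .$$ Then there is $T=T(n,\tau)>0$, depending only on $n$ and $\tau$, such that for every integer $m\ge 0$ with $m\tau>T$, $$\inf_{x\in[0,1]}\mathbb E\big|u^{n,\tau}(m\tau,\kappa_n(x))\big|^2\ \ge\ C_1e^{C_2J_0^4\lambda^4m\tau},\qquad C_1=\frac{16\pi\zeta I_0^2}{J_0^2+32\pi\zeta},\quad C_2=\frac{4\pi^2\zeta^2}{(J_0^2+32\pi\zeta)^2}.$$ -/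

import Mathlib

open MeasureTheory ProbabilityTheory Set

noncomputable section

namespace StochHeat

/-- The Borel subsets of `[0,∞) × [0,1]` (time × space) of finite area. -/
def BorelSets : Set (Set (ℝ × ℝ)) :=
  {A | MeasurableSet A ∧ A ⊆ Ici (0 : ℝ) ×ˢ Icc (0 : ℝ) 1 ∧ volume A < ⊤}

/-- Space-time white noise on `[0,∞) × [0,1]`: a centred Gaussian random field indexed by the Borel
sets of finite area, with covariance `𝔼[W(A) W(B)] = |A ∩ B|`. -/
structure IsWhiteNoise {Ω : Type*} [MeasurableSpace Ω] (P : Measure Ω)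
    (W : Set (ℝ × ℝ) → Ω → ℝ) : Prop where
  gaussian : IsGaussianProcess (fun A : BorelSets => W A) P
  mean_zero : ∀ A ∈ BorelSets, ∫ ω, W A ω ∂P = 0
  covariance : ∀ A ∈ BorelSets, ∀ B ∈ BorelSets,
    ∫ ω, W A ω * W B ω ∂P = volume.real (A ∩ B)

/-- The Brownian sheet `W(t,x) = W([0,t] × [0,x])` of a white noise. -/
def sheet {Ω : Type*} (W : Set (ℝ × ℝ) → Ω → ℝ) (t x : ℝ) (ω : Ω) : ℝ :=
  W (Icc 0 t ×ˢ Icc 0 x) ω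

/-- The discrete Laplacian `n² (v_{j+1} - 2 v_j + v_{j-1})` with periodic boundary condition: the
grid points `x_j = j/n` are indexed by `ZMod n`, so that `x_n = x_0` and `x_{-1} = x_{n-1}`. -/
def discreteLaplacian (n : ℕ) (v : ZMod n → ℝ) (j : ZMod n) : ℝ :=
  (n : ℝ) ^ 2 * (v (j + 1) - 2 * v j + v (j - 1))

/-- The discretized noise at `(t_i, x_j)`, where `t_i = iτ` and `x_j = j/n` with `0 ≤ j < n`:
`n τ⁻¹ (W(t_{i+1},x_{j+1}) - W(t_i,x_{j+1}) - W(t_{i+1},x_j) + W(t_i,x_j))`. -/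
def discreteNoise {Ω : Type*} (W : Set (ℝ × ℝ) → Ω → ℝ) (n : ℕ) (τ : ℝ) (i : ℕ) (j : ZMod n)
    (ω : Ω) : ℝ :=
  n * τ⁻¹ *
    (sheet W ((i + 1 : ℝ) * τ) ((j.val + 1 : ℝ) / n) ω - sheet W (i * τ) ((j.val + 1 : ℝ) / n) ω
      - sheet W ((i + 1 : ℝ) * τ) ((j.val : ℝ) / n) ω + sheet W (i * τ) ((j.val : ℝ) / n) ω)

/-- `u i j` (the value at `(t_i, x_j) = (iτ, j/n)`) is the solution of the `θ`-scheme
`u(t_{i+1},x_j) = u(t_i,x_j) + (1-θ) τ Δₙ u(t_i,·)(x_j) + θ τ Δₙ u(t_{i+1},·)(x_j)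
  + λ τ σ(u(t_i,x_j)) □W(t_i,x_j)`, `u(0,x_j) = u₀(x_j)`. -/
def IsThetaScheme {Ω : Type*} [MeasurableSpace Ω] (P : Measure Ω) (W : Set (ℝ × ℝ) → Ω → ℝ)
    (σ u₀ : ℝ → ℝ) (lam θ : ℝ) (n : ℕ) (τ : ℝ) (u : ℕ → ZMod n → Ω → ℝ) : Prop :=
  ∀ᵐ ω ∂P,
    (∀ j : ZMod n, u 0 j ω = u₀ ((j.val : ℝ) / n)) ∧
    ∀ (i : ℕ) (j : ZMod n),
      u (i + 1) j ω = u i j ω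
        + (1 - θ) * τ * discreteLaplacian n (fun k => u i k ω) j
        + θ * τ * discreteLaplacian n (fun k => u (i + 1) k ω) j
        + lam * τ * σ (u i j ω) * discreteNoise W n τ i j ω

/-- `κₙ(x) = [n x] / n`. -/
def kappa (n : ℕ) (x : ℝ) : ℝ := (⌊(n : ℝ) * x⌋ : ℝ) / n

/-- Extension of a periodic grid function to real arguments by linear interpolation:
`v(x) = v(κₙ(x)) + n (x - κₙ(x)) (v(κₙ(x) + 1/n) - v(κₙ(x)))`. -/
def interpolate (n : ℕ) (v : ZMod n → ℝ) (x : ℝ) : ℝ :=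
  v (⌊(n : ℝ) * x⌋ : ZMod n) + n * (x - kappa n x) *
    (v ((⌊(n : ℝ) * x⌋ : ZMod n) + 1) - v (⌊(n : ℝ) * x⌋ : ZMod n))

/-- `J₀ = inf_{x ≠ 0} |σ(x)/x|`. -/
def J0 (σ : ℝ → ℝ) : ℝ := ⨅ x : {x : ℝ // x ≠ 0}, |σ x / x|

end StochHeat

end

/-!
With `R = (1 - θτΔₙ)⁻¹` and `A = 1 + (1-θ)τΔₙ`, one step of the scheme reads
`u_{m+1} = R (A u_m + λτ σ(u_m) □W_m)`. The noise `□W_m` is centred, has uncorrelated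
components of variance `n/τ`, and is independent of `u_m`, which is a functional of the earlier
noise. Iterating the one-step isometry `integral_sq_add_sum_noise` along the dual dynamics
`w ↦ A R w` gives the mild formulation in mean square (`integral_sq_noiseSolution`)

  `E u_m(x_j)² = I₀² + λ² τ n ∑_{r<m} ∑_k (R (AR)^r e_j)(k)² E σ(u_{m-1-r}(x_k))²`.

By Parseval, `n ∑_k (R (AR)^r e_j)(k)²` is a sum of squares over the Fourier modes `l`. Since
`-Δₙ` has eigenvalue at most `4π²l²` on the mode `l`, and both multipliers `ρ_l` of `R` and
`μ_l` of `R A` are at least `1 - x` with `x = 4π²M²τ` for `|l| ≤ M`, whatever `θ` is, keeping these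
`2M + 1` modes bounds the sum below by `(2M + 1) (1 - x)^{2(r+1)}` (`le_sum_sq_kernel`). Together
with `σ(y)² ≥ J₀² y²` this is a renewal inequality with a geometric kernel, which forces
`E u_m(x_j)² ≥ I₀² κ^m` with `κ = (1 - x)² (1 + λ² J₀² τ (2M + 1))`
(`pow_le_one_add_renewal_sum`, `pow_le_integral_sq_noiseSolution`).

It remains to choose `M`. The claimed rate is `z²` with `z = 2πζλ²J₀² / (J₀² + 32πζ)`, and
`λ² J₀² ≥ 16 z`. With `M` the integer part of `z / (4π)`, the gain `16 z (2M + 1)` of the noise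
exceeds the loss `8π²M²` of the heat flow plus the rate `z²` by a factor `4/π` or more, which leaves
room for the errors of order two in `τ` (`exp_le_growth_factor`). The assumption `λ² ζ ≤ n` gives
`z < 2πn`, so that `2M + 1 ≤ n` modes are available, and the stability condition makes `z² τ`
small. Hence `κ ≥ exp (z² τ)`, and the bound holds from the first time step on.
-/

namespace StochHeat

/-! ### The discrete Laplacian and its resolvent -/

/-- The discrete Laplacian as an endomorphism of the space of periodic grid functions. -/
def gridLaplacian (n : ℕ) : Module.End ℝ (ZMod n → ℝ) where
  toFun := discreteLaplacian n
  map_add' v w := by ext j; simp only [discreteLaplacian, Pi.add_apply]; ring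
  map_smul' c v := by
    ext j; simp only [discreteLaplacian, Pi.smul_apply, smul_eq_mul, RingHom.id_apply]; ring

lemma gridLaplacian_apply (n : ℕ) (v : ZMod n → ℝ) (j : ZMod n) :
    gridLaplacian n v j = discreteLaplacian n v j := rfl

lemma gridLaplacian_const (n : ℕ) (c : ℝ) : gridLaplacian n (fun _ => c) = 0 := by
  ext j; simp only [gridLaplacian_apply, discreteLaplacian, Pi.zero_apply]; ring

/-- The explicit part `1 + aΔₙ` of the scheme, with `a = (1-θ)τ`. -/
noncomputable def explicitStep (n : ℕ) (a : ℝ) : Module.End ℝ (ZMod n → ℝ) :=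
  1 + a • gridLaplacian n

/-- The inverse `(1 - aΔₙ)⁻¹` of the implicit part of the scheme, with `a = θτ`. It is a genuine
inverse for `a ≥ 0`, see `isUnit_implicitStep`. -/
noncomputable def resolvent (n : ℕ) (a : ℝ) : Module.End ℝ (ZMod n → ℝ) :=
  Ring.inverse (1 - a • gridLaplacian n)

lemma explicitStep_apply (n : ℕ) (b : ℝ) (v : ZMod n → ℝ) :
    explicitStep n b v = v + b • gridLaplacian n v := rfl

lemma explicitStep_const (n : ℕ) (b c : ℝ) : explicitStep n b (fun _ => c) = fun _ => c := by
  rw [explicitStep_apply, gridLaplacian_const, smul_zero, add_zero]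

/-- The dual one-step operator: testing the scheme against `w` at one time amounts to testing it
against `dualStep w` one time step earlier, up to the noise term. -/
noncomputable def dualStep (n : ℕ) (a b : ℝ) : Module.End ℝ (ZMod n → ℝ) :=
  explicitStep n b * resolvent n a

lemma dualStep_apply (n : ℕ) (a b : ℝ) (v : ZMod n → ℝ) :
    dualStep n a b v = explicitStep n b (resolvent n a v) := rfl

section Finite

variable {n : ℕ} [NeZero n]

lemma sum_mul_gridLaplacian (v w : ZMod n → ℝ) :
    ∑ j, v j * gridLaplacian n w j = ∑ j, gridLaplacian n v j * w j := by
  have h1 : ∑ j, v j * w (j + 1) = ∑ j, v (j - 1) * w j := by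
    rw [← Equiv.sum_comp (Equiv.addRight (1 : ZMod n)) (fun j => v (j - 1) * w j)]
    simp
  have h2 : ∑ j, v j * w (j - 1) = ∑ j, v (j + 1) * w j := by
    rw [← Equiv.sum_comp (Equiv.addRight (1 : ZMod n)) (fun j => v j * w (j - 1))]
    simp
  have e1 : ∀ j, v j * gridLaplacian n w j
      = (n : ℝ) ^ 2 * (v j * w (j + 1) - 2 * (v j * w j) + v j * w (j - 1)) := fun j => by
    simp only [gridLaplacian_apply, discreteLaplacian]; ring
  have e2 : ∀ j, gridLaplacian n v j * w j
      = (n : ℝ) ^ 2 * (v (j + 1) * w j - 2 * (v j * w j) + v (j - 1) * w j) := fun j => by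
    simp only [gridLaplacian_apply, discreteLaplacian]; ring
  simp only [e1, e2, ← Finset.mul_sum, Finset.sum_add_distrib, Finset.sum_sub_distrib, h1, h2]
  ring

/-! ### Fourier analysis of the scheme -/

/-- The discrete Fourier transform of a real grid function. -/
noncomputable def realDFT (v : ZMod n → ℝ) : ZMod n → ℂ := ZMod.dft fun j => (v j : ℂ)

/-- The eigenvalue `n² (2 - 2 cos (2πl/n))` of `-Δₙ` on the `l`-th Fourier mode. -/
noncomputable def laplacianEigenvalue (l : ZMod n) : ℝ :=
  (n : ℝ) ^ 2 * (2 - 2 * (ZMod.stdAddChar l).re)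

lemma laplacianEigenvalue_nonneg (l : ZMod n) : 0 ≤ laplacianEigenvalue l := by
  have h : (ZMod.stdAddChar l).re ≤ 1 := by
    simpa using Complex.re_le_norm (ZMod.stdAddChar l)
  unfold laplacianEigenvalue
  have : (0 : ℝ) ≤ 2 - 2 * (ZMod.stdAddChar l).re := by linarith
  positivity

lemma laplacianEigenvalue_intCast_le (l : ℤ) :
    laplacianEigenvalue (l : ZMod n) ≤ 4 * Real.pi ^ 2 * (l : ℝ) ^ 2 := by
  have hn : (n : ℝ) ≠ 0 := Nat.cast_ne_zero.2 (NeZero.ne n)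
  have h : (ZMod.stdAddChar (l : ZMod n)).re = Real.cos (2 * Real.pi * l / n) := by
    rw [ZMod.stdAddChar_coe, ← Complex.exp_ofReal_mul_I_re]
    congr 2
    push_cast
    ring
  have hc := Real.one_sub_sq_div_two_le_cos (x := 2 * Real.pi * l / n)
  unfold laplacianEigenvalue
  rw [h]
  calc (n : ℝ) ^ 2 * (2 - 2 * Real.cos (2 * Real.pi * l / n))
      ≤ (n : ℝ) ^ 2 * (2 * Real.pi * l / n) ^ 2 := by gcongr; linarith
    _ = 4 * Real.pi ^ 2 * (l : ℝ) ^ 2 := by field_simp; ring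

lemma realDFT_add (v w : ZMod n → ℝ) : realDFT (v + w) = realDFT v + realDFT w := by
  simp only [realDFT, ← map_add]
  congr 1
  ext j
  simp

lemma realDFT_smul (c : ℝ) (v : ZMod n → ℝ) : realDFT (c • v) = (c : ℂ) • realDFT v := by
  simp only [realDFT, ← map_smul]
  congr 1
  ext j
  simp

lemma realDFT_gridLaplacian (v : ZMod n → ℝ) (l : ZMod n) :
    realDFT (gridLaplacian n v) l = -(laplacianEigenvalue l : ℂ) * realDFT v l := by
  obtain ⟨χ, hχ⟩ : ∃ χ, χ = ZMod.stdAddChar (N := n) := ⟨_, rfl⟩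
  have hp : ∑ j, χ (-(j * l)) * (v (j + 1) : ℂ) = χ l * ∑ j, χ (-(j * l)) * (v j : ℂ) := by
    rw [← Equiv.sum_comp (Equiv.addRight (1 : ZMod n)) (fun j => χ (-(j * l)) * (v j : ℂ)),
      Finset.mul_sum]
    refine Finset.sum_congr rfl fun j _ => ?_
    rw [← mul_assoc, ← AddChar.map_add_eq_mul]
    congr 2
    simp only [Equiv.coe_addRight]
    ring
  have hm : ∑ j, χ (-(j * l)) * (v (j - 1) : ℂ) = χ (-l) * ∑ j, χ (-(j * l)) * (v j : ℂ) := by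
    rw [← Equiv.sum_comp (Equiv.addRight (-1 : ZMod n)) (fun j => χ (-(j * l)) * (v j : ℂ)),
      Finset.mul_sum]
    refine Finset.sum_congr rfl fun j _ => ?_
    rw [← mul_assoc, ← AddChar.map_add_eq_mul]
    congr 2
    · simp only [Equiv.coe_addRight]
      ring
    · simp only [Equiv.coe_addRight, sub_eq_add_neg]
  have hre : χ l + χ (-l) = 2 * ((χ l).re : ℂ) := by
    rw [AddChar.map_neg_eq_conj, Complex.add_conj]
    push_cast
    ring
  have e : ∀ j, χ (-(j * l)) * ((gridLaplacian n v j : ℝ) : ℂ)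
      = (n : ℂ) ^ 2 * (χ (-(j * l)) * (v (j + 1) : ℂ) - 2 * (χ (-(j * l)) * (v j : ℂ))
        + χ (-(j * l)) * (v (j - 1) : ℂ)) := fun j => by
    simp only [gridLaplacian_apply, discreteLaplacian]; push_cast; ring
  simp only [realDFT, ZMod.dft_apply, smul_eq_mul, laplacianEigenvalue, ← hχ]
  simp only [e, ← Finset.mul_sum, Finset.sum_add_distrib, Finset.sum_sub_distrib, hp, hm]
  push_cast
  linear_combination (n : ℂ) ^ 2 * (∑ j, χ (-(j * l)) * (v j : ℂ)) * hre

/-- Parseval's identity. -/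
lemma sum_norm_sq_realDFT (v : ZMod n → ℝ) :
    ∑ l, ‖realDFT v l‖ ^ 2 = n * ∑ j, v j ^ 2 := by
  have hconj : ∀ l, (starRingEnd ℂ) (realDFT v l)
      = ∑ j, ZMod.stdAddChar (j * l) * (v j : ℂ) := fun l => by
    simp only [realDFT, ZMod.dft_apply, map_sum, smul_eq_mul, map_mul, Complex.conj_ofReal,
      ← AddChar.map_neg_eq_conj, neg_neg]
  have hinv : ∀ j, ∑ l, ZMod.stdAddChar (j * l) * realDFT v l = n * (v j : ℂ) := fun j => by
    have h := congrFun (ZMod.dft_dft fun j => (v j : ℂ)) (-j)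
    rw [ZMod.dft_apply] at h
    simp only [neg_neg, smul_eq_mul] at h
    rw [← h]
    refine Finset.sum_congr rfl fun l _ => ?_
    simp only [realDFT]
    congr 2
    ring
  have key : ∑ l, realDFT v l * (starRingEnd ℂ) (realDFT v l)
      = n * ∑ j, (v j : ℂ) ^ 2 := by
    simp only [hconj, Finset.mul_sum]
    rw [Finset.sum_comm]
    refine Finset.sum_congr rfl fun j _ => ?_
    rw [pow_two, ← mul_assoc, ← hinv j, Finset.sum_mul]
    exact Finset.sum_congr rfl fun l _ => by ring
  have : ((∑ l, ‖realDFT v l‖ ^ 2 : ℝ) : ℂ) = ((n * ∑ j, v j ^ 2 : ℝ) : ℂ) := by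
    push_cast
    rw [← key]
    exact Finset.sum_congr rfl fun l _ => (Complex.mul_conj' _).symm
  exact_mod_cast this

variable {a : ℝ}

lemma isUnit_implicitStep (ha : 0 ≤ a) : IsUnit (1 - a • gridLaplacian n) := by
  rw [LinearMap.isUnit_iff_ker_eq_bot, LinearMap.ker_eq_bot']
  intro v hv
  have hv' : v + (-a) • gridLaplacian n v = 0 := by
    rw [← hv]
    simp [sub_eq_add_neg]
  have h0 : ∀ l, realDFT v l = 0 := fun l => by
    have h := congrFun (congrArg realDFT hv') l
    rw [realDFT_add, realDFT_smul] at h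
    simp only [Pi.add_apply, Pi.smul_apply, smul_eq_mul, realDFT_gridLaplacian] at h
    have hz : realDFT (0 : ZMod n → ℝ) l = 0 := by simp [realDFT, ZMod.dft_apply]
    rw [hz] at h
    have h' : ((1 + a * laplacianEigenvalue l : ℝ) : ℂ) * realDFT v l = 0 := by
      push_cast at h ⊢
      linear_combination h
    have hpos : 0 < 1 + a * laplacianEigenvalue l := by
      have := mul_nonneg ha (laplacianEigenvalue_nonneg l)
      linarith
    rcases mul_eq_zero.1 h' with h1 | h1
    · exact absurd (by exact_mod_cast h1) hpos.ne'
    · exact h1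
  have hP := sum_norm_sq_realDFT v
  simp only [h0, norm_zero, ne_eq, OfNat.ofNat_ne_zero, not_false_eq_true, zero_pow,
    Finset.sum_const_zero] at hP
  have hs : ∑ j, v j ^ 2 = 0 := by
    rcases mul_eq_zero.1 hP.symm with h | h
    · exact absurd h (Nat.cast_ne_zero.2 (NeZero.ne n))
    · exact h
  ext j
  have := (Finset.sum_eq_zero_iff_of_nonneg fun j _ => sq_nonneg (v j)).1 hs j (Finset.mem_univ j)
  simpa using this

lemma resolvent_sub (ha : 0 ≤ a) (v : ZMod n → ℝ) :
    resolvent n a (v - a • gridLaplacian n v) = v :=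
  LinearMap.congr_fun (Ring.inverse_mul_cancel _ (isUnit_implicitStep ha)) v

lemma sub_resolvent (ha : 0 ≤ a) (v : ZMod n → ℝ) :
    resolvent n a v - a • gridLaplacian n (resolvent n a v) = v :=
  LinearMap.congr_fun (Ring.mul_inverse_cancel _ (isUnit_implicitStep ha)) v

lemma resolvent_const (ha : 0 ≤ a) (c : ℝ) :
    resolvent n a (fun _ => c) = fun _ => c := by
  conv_rhs => rw [← resolvent_sub ha (fun _ => c)]
  rw [gridLaplacian_const, smul_zero, sub_zero]

lemma sum_mul_explicitStep (b : ℝ) (v w : ZMod n → ℝ) :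
    ∑ j, v j * explicitStep n b w j = ∑ j, explicitStep n b v j * w j := by
  have h := sum_mul_gridLaplacian v w
  simp only [explicitStep_apply, Pi.add_apply, Pi.smul_apply, smul_eq_mul, mul_add, add_mul,
    Finset.sum_add_distrib]
  simp only [mul_left_comm (v _) b, mul_assoc b, ← Finset.mul_sum, h]

lemma sum_mul_resolvent (ha : 0 ≤ a) (v w : ZMod n → ℝ) :
    ∑ j, v j * resolvent n a w j = ∑ j, resolvent n a v j * w j := by
  conv_lhs => rw [← sub_resolvent ha v]
  conv_rhs => rw [← sub_resolvent ha w]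
  have h := sum_mul_gridLaplacian (resolvent n a v) (resolvent n a w)
  simp only [Pi.sub_apply, Pi.smul_apply, smul_eq_mul, mul_sub, sub_mul,
    Finset.sum_sub_distrib]
  simp only [mul_left_comm (resolvent n a v _) a, mul_assoc a, ← Finset.mul_sum, h]

lemma realDFT_resolvent (ha : 0 ≤ a) (v : ZMod n → ℝ) (l : ZMod n) :
    realDFT (resolvent n a v) l
      = ((1 / (1 + a * laplacianEigenvalue l) : ℝ) : ℂ) * realDFT v l := by
  have hpos : 0 < 1 + a * laplacianEigenvalue l := by
    have := mul_nonneg ha (laplacianEigenvalue_nonneg l)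
    linarith
  have hv : resolvent n a v + (-a) • gridLaplacian n (resolvent n a v) = v := by
    rw [neg_smul, ← sub_eq_add_neg, sub_resolvent ha]
  have h := congrFun (congrArg realDFT hv) l
  rw [realDFT_add, realDFT_smul] at h
  simp only [Pi.add_apply, Pi.smul_apply, smul_eq_mul, realDFT_gridLaplacian] at h
  have hc : (1 + a * laplacianEigenvalue l : ℂ) ≠ 0 := by exact_mod_cast hpos.ne'
  rw [← h]
  push_cast
  field_simp

lemma realDFT_explicitStep (b : ℝ) (v : ZMod n → ℝ) (l : ZMod n) :
    realDFT (explicitStep n b v) l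
      = ((1 - b * laplacianEigenvalue l : ℝ) : ℂ) * realDFT v l := by
  rw [explicitStep_apply, realDFT_add, realDFT_smul]
  simp only [Pi.add_apply, Pi.smul_apply, smul_eq_mul, realDFT_gridLaplacian]
  push_cast
  ring

lemma norm_realDFT_single (j l : ZMod n) : ‖realDFT (Pi.single j (1 : ℝ)) l‖ = 1 := by
  have : realDFT (Pi.single j (1 : ℝ)) l = ZMod.stdAddChar (-(j * l)) := by
    rw [realDFT, ZMod.dft_apply, Finset.sum_eq_single j]
    · simp
    · intro k _ hk
      simp [Pi.single_eq_of_ne hk]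
    · simp
  rw [this, AddChar.norm_apply]

lemma sum_dualStep (ha : 0 ≤ a) (b : ℝ) (v : ZMod n → ℝ) :
    ∑ j, dualStep n a b v j = ∑ j, v j := by
  have h1 := sum_mul_explicitStep b (resolvent n a v) (fun _ => 1)
  have h2 := sum_mul_resolvent ha v (fun _ => 1)
  rw [explicitStep_const] at h1
  rw [resolvent_const ha] at h2
  simp only [mul_one] at h1 h2
  rw [h2, h1]
  rfl

lemma norm_realDFT_kernel (ha : 0 ≤ a) (b : ℝ) (r : ℕ) (j l : ZMod n) :
    ‖realDFT (resolvent n a ((dualStep n a b ^ r) (Pi.single j 1))) l‖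
      = 1 / (1 + a * laplacianEigenvalue l)
        * |(1 - b * laplacianEigenvalue l) / (1 + a * laplacianEigenvalue l)| ^ r := by
  have hpos : 0 < 1 + a * laplacianEigenvalue l := by
    have := mul_nonneg ha (laplacianEigenvalue_nonneg l)
    linarith
  have h : ‖realDFT ((dualStep n a b ^ r) (Pi.single j 1)) l‖
      = |(1 - b * laplacianEigenvalue l) / (1 + a * laplacianEigenvalue l)| ^ r := by
    induction r with
    | zero => simp [norm_realDFT_single]
    | succ r ih =>
      rw [pow_succ', Module.End.mul_apply, dualStep_apply, realDFT_explicitStep,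
        realDFT_resolvent ha, norm_mul, norm_mul, ih, Complex.norm_real, Complex.norm_real,
        Real.norm_eq_abs, Real.norm_eq_abs, ← mul_assoc, ← abs_mul, mul_one_div, pow_succ']
  rw [realDFT_resolvent ha, norm_mul, h, Complex.norm_real, Real.norm_eq_abs,
    abs_of_pos (one_div_pos.2 hpos)]

/-- On a mode with `τ`-scaled eigenvalue at most `x ≤ 1`, both the resolvent and the one-step
multiplier of the `θ`-scheme are at least `1 - x`, whatever `θ` is. -/
lemma one_sub_pow_le_norm_realDFT_kernel {θ τ x : ℝ} (hθ0 : 0 ≤ θ) (hθ1 : θ ≤ 1) (hτ : 0 ≤ τ)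
    (hx : x ≤ 1) (r : ℕ) (j l : ZMod n) (hl : τ * laplacianEigenvalue l ≤ x) :
    (1 - x) ^ (r + 1)
      ≤ ‖realDFT (resolvent n (θ * τ)
          ((dualStep n (θ * τ) ((1 - θ) * τ) ^ r) (Pi.single j 1))) l‖ := by
  have he : 0 ≤ τ * laplacianEigenvalue l := mul_nonneg hτ (laplacianEigenvalue_nonneg l)
  rw [norm_realDFT_kernel (mul_nonneg hθ0 hτ), mul_assoc, mul_assoc]
  set y := τ * laplacianEigenvalue l
  have hθy : 0 ≤ θ * y := mul_nonneg hθ0 he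
  have hpos : 0 < 1 + θ * y := by linarith
  have h1 : 1 - x ≤ 1 / (1 + θ * y) := by
    rw [le_div_iff₀ hpos]
    nlinarith
  have h2 : 1 - x ≤ |(1 - (1 - θ) * y) / (1 + θ * y)| := by
    refine le_trans ?_ (le_abs_self _)
    rw [le_div_iff₀ hpos]
    nlinarith
  have hx0 : 0 ≤ 1 - x := by linarith
  rw [pow_succ']
  gcongr

/-- Lower bound for the `ℓ²` norm of the Green function of the scheme: by Parseval it is a sum of
squares over the Fourier modes, of which the `2M + 1` lowest ones are kept. -/
lemma le_sum_sq_kernel {θ τ : ℝ} (hθ0 : 0 ≤ θ) (hθ1 : θ ≤ 1) (hτ : 0 ≤ τ) (M : ℕ)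
    (hM : 2 * M + 1 ≤ n) (hx : 4 * Real.pi ^ 2 * (M : ℝ) ^ 2 * τ ≤ 1) (r : ℕ) (j : ZMod n) :
    (2 * M + 1) * ((1 - 4 * Real.pi ^ 2 * (M : ℝ) ^ 2 * τ) ^ 2) ^ (r + 1)
      ≤ n * ∑ k, resolvent n (θ * τ)
          ((dualStep n (θ * τ) ((1 - θ) * τ) ^ r) (Pi.single j 1)) k ^ 2 := by
  rw [← sum_norm_sq_realDFT]
  set F := realDFT (resolvent n (θ * τ) ((dualStep n (θ * τ) ((1 - θ) * τ) ^ r) (Pi.single j 1)))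
    with hF
  set x := 4 * Real.pi ^ 2 * (M : ℝ) ^ 2 * τ with hxdef
  let s : Finset ℤ := Finset.Icc (-(M : ℤ)) M
  have hinj : Set.InjOn (fun l : ℤ => (l : ZMod n)) s := by
    intro l hl l' hl' h
    simp only [s, Finset.coe_Icc, Set.mem_Icc] at hl hl'
    rw [ZMod.intCast_eq_intCast_iff_dvd_sub] at h
    have := Int.eq_zero_of_abs_lt_dvd h (by rw [abs_lt]; constructor <;> omega)
    omega
  have hcard : (s.card : ℝ) = 2 * M + 1 := by
    have : s.card = 2 * M + 1 := by simp only [s, Int.card_Icc]; omega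
    rw [this]; push_cast; ring
  have hb : ∀ l ∈ s, ((1 - x) ^ 2) ^ (r + 1) ≤ ‖F (l : ZMod n)‖ ^ 2 := by
    intro l hl
    simp only [s, Finset.mem_Icc] at hl
    have hlM : (l : ℝ) ^ 2 ≤ (M : ℝ) ^ 2 := by
      rw [sq_le_sq, Nat.abs_cast, abs_le]
      exact ⟨by exact_mod_cast hl.1, by exact_mod_cast hl.2⟩
    have hle : τ * laplacianEigenvalue (l : ZMod n) ≤ x := by
      calc τ * laplacianEigenvalue (l : ZMod n) ≤ τ * (4 * Real.pi ^ 2 * (l : ℝ) ^ 2) := by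
            gcongr; exact laplacianEigenvalue_intCast_le l
        _ ≤ τ * (4 * Real.pi ^ 2 * (M : ℝ) ^ 2) := by gcongr
        _ = x := by rw [hxdef]; ring
    have h := one_sub_pow_le_norm_realDFT_kernel hθ0 hθ1 hτ hx r j (l : ZMod n) hle
    rw [← pow_mul, mul_comm 2, pow_mul]
    have h0 : 0 ≤ (1 - x) ^ (r + 1) := pow_nonneg (by linarith) _
    gcongr
  calc (2 * M + 1) * ((1 - x) ^ 2) ^ (r + 1) = ∑ _l ∈ s, ((1 - x) ^ 2) ^ (r + 1) := by
        rw [Finset.sum_const, nsmul_eq_mul, hcard]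
    _ ≤ ∑ l ∈ s, ‖F (l : ZMod n)‖ ^ 2 := Finset.sum_le_sum hb
    _ = ∑ l ∈ s.image (fun l : ℤ => (l : ZMod n)), ‖F l‖ ^ 2 := by
        rw [Finset.sum_image hinj]
    _ ≤ ∑ l, ‖F l‖ ^ 2 :=
        Finset.sum_le_sum_of_subset_of_nonneg (Finset.subset_univ _) fun _ _ _ => sq_nonneg _

end Finite

/-! ### The discretized noise -/

section Noise

lemma rectangle_mem_borelSets {x : ℝ} (t : ℝ) (hx : x ≤ 1) :
    Icc 0 t ×ˢ Icc 0 x ∈ BorelSets :=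
  ⟨measurableSet_Icc.prod measurableSet_Icc,
    prod_mono Icc_subset_Ici_self (Icc_subset_Icc_right hx),
    (isCompact_Icc.prod isCompact_Icc).measure_lt_top⟩

lemma volume_real_rectangle_inter {s t x y : ℝ} (hs : 0 ≤ s) (ht : 0 ≤ t) (hx : 0 ≤ x)
    (hy : 0 ≤ y) :
    volume.real ((Icc 0 s ×ˢ Icc 0 x) ∩ (Icc 0 t ×ˢ Icc 0 y) : Set (ℝ × ℝ))
      = min s t * min x y := by
  rw [prod_inter_prod, Icc_inter_Icc, Icc_inter_Icc, Measure.volume_eq_prod,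
    measureReal_prod_prod, sup_idem, Real.volume_real_Icc_of_le (le_min hs ht),
    Real.volume_real_Icc_of_le (le_min hx hy), sub_zero, sub_zero]

/-- A corner of the space-time cell at `(t_i, x_j)`, as the Borel set `[0,t] × [0,x]` that it
spans with the origin; the two booleans select the later time and the right end point. -/
def cellCorner {n : ℕ} (τ : ℝ) (i : ℕ) (j : ZMod n) (e : Bool × Bool) : Set (ℝ × ℝ) :=
  Icc 0 ((i + if e.1 then 1 else 0 : ℝ) * τ) ×ˢ
    Icc 0 ((j.val + if e.2 then 1 else 0 : ℝ) * (1 / n))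

/-- The sign with which a corner of a cell enters the mixed difference over the cell. -/
def cornerSign (e : Bool × Bool) : ℝ := (if e.1 then 1 else -1) * (if e.2 then 1 else -1)

lemma discreteNoise_eq_sum {Ω : Type*} (W : Set (ℝ × ℝ) → Ω → ℝ) (n : ℕ) (τ : ℝ) (i : ℕ)
    (j : ZMod n) (ω : Ω) :
    discreteNoise W n τ i j ω
      = n * τ⁻¹ * ∑ e : Bool × Bool, cornerSign e * W (cellCorner τ i j e) ω := by
  simp only [discreteNoise, sheet, cellCorner, cornerSign, Fintype.sum_prod_type,
    Fintype.sum_bool, if_true, Bool.false_eq_true, if_false, add_zero, mul_one_div]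
  ring

variable {Ω : Type*} [MeasurableSpace Ω] {P : Measure Ω} {W : Set (ℝ × ℝ) → Ω → ℝ}
  {n : ℕ} [NeZero n] {τ : ℝ}

lemma cellCorner_mem_borelSets (τ : ℝ) (i : ℕ) (j : ZMod n) (e : Bool × Bool) :
    cellCorner τ i j e ∈ BorelSets := by
  refine rectangle_mem_borelSets _ ?_
  have hn : (0 : ℝ) < n := Nat.cast_pos.2 (NeZero.pos n)
  have hj : (j.val : ℝ) + 1 ≤ n := by exact_mod_cast ZMod.val_lt j
  rw [mul_one_div, div_le_one hn]
  split_ifs <;> linarith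

lemma isGaussianProcess_discreteNoise (hW : IsWhiteNoise P W) (n : ℕ) [NeZero n] (τ : ℝ) :
    IsGaussianProcess (fun p : ℕ × ZMod n => discreteNoise W n τ p.1 p.2) P := by
  classical
  refine hW.gaussian.of_isGaussianProcess fun p => ?_
  let A : Bool × Bool → BorelSets := fun e => ⟨_, cellCorner_mem_borelSets τ p.1 p.2 e⟩
  refine ⟨Finset.univ.image A, ((n : ℝ) * τ⁻¹) • ∑ e : Bool × Bool, cornerSign e •
    ContinuousLinearMap.proj (R := ℝ) (φ := fun _ : Finset.univ.image A => ℝ)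
      ⟨A e, Finset.mem_image_of_mem _ (Finset.mem_univ e)⟩, fun ω => ?_⟩
  rw [discreteNoise_eq_sum]
  simp [A]

lemma memLp_whiteNoise (hW : IsWhiteNoise P W) {A : Set (ℝ × ℝ)} (hA : A ∈ BorelSets) :
    MemLp (W A) 2 P :=
  (hW.gaussian.hasGaussianLaw_eval ⟨A, hA⟩).memLp_two

lemma memLp_discreteNoise (hW : IsWhiteNoise P W) (τ : ℝ) (i : ℕ) (j : ZMod n) :
    MemLp (discreteNoise W n τ i j) 2 P :=
  ((isGaussianProcess_discreteNoise hW n τ).hasGaussianLaw_eval (i, j)).memLp_two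

lemma integral_discreteNoise [IsProbabilityMeasure P] (hW : IsWhiteNoise P W) (τ : ℝ) (i : ℕ)
    (j : ZMod n) : ∫ ω, discreteNoise W n τ i j ω ∂P = 0 := by
  simp only [discreteNoise_eq_sum]
  rw [integral_const_mul, integral_finsetSum]
  · simp only [integral_const_mul, hW.mean_zero _ (cellCorner_mem_borelSets τ i j _), mul_zero,
      Finset.sum_const_zero]
  · exact fun e _ => ((memLp_whiteNoise hW
      (cellCorner_mem_borelSets τ i j e)).integrable (by norm_num)).const_mul _

/-- The covariance of two increments `[ic, (i+1)c]` and `[i'c, (i'+1)c]` of Brownian motion. -/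
lemma mixed_difference_min {c : ℝ} (hc : 0 < c) (i i' : ℕ) :
    min ((i + 1 : ℝ) * c) ((i' + 1 : ℝ) * c) - min ((i : ℝ) * c) ((i' + 1 : ℝ) * c)
      - min ((i + 1 : ℝ) * c) ((i' : ℝ) * c) + min ((i : ℝ) * c) ((i' : ℝ) * c)
      = if i = i' then c else 0 := by
  simp only [← min_mul_of_nonneg _ _ hc.le]
  rcases lt_trichotomy i i' with h | rfl | h
  · have h' : (i : ℝ) + 1 ≤ i' := by exact_mod_cast h
    rw [if_neg h.ne, min_eq_left (by linarith), min_eq_left (by linarith), min_eq_left h',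
      min_eq_left (by linarith)]
    ring
  · rw [if_pos rfl, min_self, min_self, min_eq_left (by linarith), min_eq_right (by linarith)]
    ring
  · have h' : (i' : ℝ) + 1 ≤ i := by exact_mod_cast h
    rw [if_neg h.ne', min_eq_right (by linarith), min_eq_right h', min_eq_right (by linarith),
      min_eq_right (by linarith)]
    ring

lemma integral_discreteNoise_mul (hW : IsWhiteNoise P W) (hτ : 0 < τ) (i i' : ℕ)
    (j j' : ZMod n) :
    ∫ ω, discreteNoise W n τ i j ω * discreteNoise W n τ i' j' ω ∂P
      = if i = i' ∧ j = j' then n / τ else 0 := by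
  have hn : (0 : ℝ) < n := Nat.cast_pos.2 (NeZero.pos n)
  have hint : ∀ e f,
      Integrable (fun ω => W (cellCorner τ i j e) ω * W (cellCorner τ i' j' f) ω) P :=
    fun e f => (memLp_whiteNoise hW (cellCorner_mem_borelSets τ i j e)).integrable_mul
      (memLp_whiteNoise hW (cellCorner_mem_borelSets τ i' j' f))
  have hcov : ∀ e f, ∫ ω, W (cellCorner τ i j e) ω * W (cellCorner τ i' j' f) ω ∂P
      = min ((i + if e.1 then 1 else 0 : ℝ) * τ) ((i' + if f.1 then 1 else 0 : ℝ) * τ)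
        * min ((j.val + if e.2 then 1 else 0 : ℝ) * (1 / n))
          ((j'.val + if f.2 then 1 else 0 : ℝ) * (1 / n)) := fun e f => by
    rw [hW.covariance _ (cellCorner_mem_borelSets τ i j e) _ (cellCorner_mem_borelSets τ i' j' f)]
    exact volume_real_rectangle_inter (by split_ifs <;> positivity) (by split_ifs <;> positivity)
      (by split_ifs <;> positivity) (by split_ifs <;> positivity)
  have hexp : ∀ ω, discreteNoise W n τ i j ω * discreteNoise W n τ i' j' ω
      = (n * τ⁻¹) ^ 2 * ∑ e : Bool × Bool, ∑ f : Bool × Bool, cornerSign e * cornerSign f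
        * (W (cellCorner τ i j e) ω * W (cellCorner τ i' j' f) ω) := fun ω => by
    rw [discreteNoise_eq_sum, discreteNoise_eq_sum, mul_mul_mul_comm, Finset.sum_mul_sum, ← pow_two]
    congr 1
    exact Finset.sum_congr rfl fun e _ => Finset.sum_congr rfl fun f _ => by ring
  simp only [hexp]
  rw [integral_const_mul, integral_finsetSum _ fun e _ => integrable_finsetSum _ fun f _ =>
    (hint e f).const_mul _]
  have hsum : ∀ e, ∫ ω, ∑ f : Bool × Bool, cornerSign e * cornerSign f
        * (W (cellCorner τ i j e) ω * W (cellCorner τ i' j' f) ω) ∂P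
      = ∑ f : Bool × Bool, cornerSign e * cornerSign f
        * ∫ ω, W (cellCorner τ i j e) ω * W (cellCorner τ i' j' f) ω ∂P := fun e => by
    rw [integral_finsetSum _ fun f _ => (hint e f).const_mul _]
    simp only [integral_const_mul]
  simp only [hsum, hcov]
  have ht := mixed_difference_min hτ i i'
  have hx := mixed_difference_min (one_div_pos.2 hn) j.val j'.val
  have hfact : ∑ e : Bool × Bool, ∑ f : Bool × Bool, cornerSign e * cornerSign f
      * (min ((i + if e.1 then 1 else 0 : ℝ) * τ) ((i' + if f.1 then 1 else 0 : ℝ) * τ)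
        * min ((j.val + if e.2 then 1 else 0 : ℝ) * (1 / n))
          ((j'.val + if f.2 then 1 else 0 : ℝ) * (1 / n)))
      = (if i = i' then τ else 0) * (if j.val = j'.val then (1 / n : ℝ) else 0) := by
    rw [← ht, ← hx]
    simp only [Fintype.sum_prod_type, Fintype.sum_bool, cornerSign, if_true, Bool.false_eq_true,
      if_false, add_zero]
    ring
  rw [hfact]
  have hval : j.val = j'.val ↔ j = j' := (ZMod.val_injective n).eq_iff
  by_cases h1 : i = i' <;> by_cases h2 : j = j' <;> simp [h1, h2, hval]
  field_simp

/-- The noise at time `t_i` is independent of the noise at all earlier times. -/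
lemma indepFun_discreteNoise [IsProbabilityMeasure P] (hW : IsWhiteNoise P W) (hτ : 0 < τ)
    (i : ℕ) :
    IndepFun (fun ω (p : {p : ℕ × ZMod n // p.1 < i}) => discreteNoise W n τ p.1.1 p.1.2 ω)
      (fun ω (k : ZMod n) => discreteNoise W n τ i k ω) P := by
  refine IsGaussianProcess.indepFun_of_covariance_eq_zero
    (X := fun p : {p : ℕ × ZMod n // p.1 < i} => discreteNoise W n τ p.1.1 p.1.2)
    (Y := fun k => discreteNoise W n τ i k) ?_
    (fun p => (memLp_discreteNoise hW τ _ _).aestronglyMeasurable.aemeasurable)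
    (fun k => (memLp_discreteNoise hW τ _ _).aestronglyMeasurable.aemeasurable) fun p k => ?_
  · refine ((isGaussianProcess_discreteNoise hW n τ).comp_right
      (Sum.elim (fun p : {p : ℕ × ZMod n // p.1 < i} => p.1) fun k : ZMod n => (i, k))).congr
      fun x => ?_
    rcases x with p | k <;> exact ae_of_all _ fun ω => rfl
  · rw [covariance_eq_sub (memLp_discreteNoise hW τ _ _) (memLp_discreteNoise hW τ _ _),
      integral_discreteNoise hW, zero_mul, sub_zero]
    have h := integral_discreteNoise_mul hW hτ p.1.1 i p.1.2 k
    rw [if_neg fun h => p.2.ne h.1] at h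
    exact h

end Noise

/-! ### One step of the second-moment recursion -/

section SecondMoment

variable {Ω E ι : Type*} [MeasurableSpace Ω] [MeasurableSpace E] [Fintype ι] {P : Measure Ω}
  {Y : Ω → E} {ξ : Ω → ι → ℝ} {f : E → ℝ} {g : ι → E → ℝ}

lemma memLp_mul_of_indepFun {A B : Ω → ℝ} (h : IndepFun A B P) (hA : MemLp A 2 P)
    (hB : MemLp B 2 P) : MemLp (fun ω => A ω * B ω) 2 P := by
  refine (memLp_two_iff_integrable_sq (hA.1.mul hB.1)).2 ?_
  have h2 : IndepFun (fun ω => A ω ^ 2) (fun ω => B ω ^ 2) P :=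
    h.comp (measurable_id.pow_const 2) (measurable_id.pow_const 2)
  refine (h2.integrable_mul hA.integrable_sq hB.integrable_sq).congr (ae_of_all _ fun ω => ?_)
  simp [mul_pow]

lemma memLp_add_sum_noise (hind : IndepFun Y ξ P) (hg : ∀ k, Measurable (g k))
    (hfY : MemLp (fun ω => f (Y ω)) 2 P) (hgY : ∀ k, MemLp (fun ω => g k (Y ω)) 2 P)
    (hξ : ∀ k, MemLp (fun ω => ξ ω k) 2 P) :
    MemLp (fun ω => f (Y ω) + ∑ k, g k (Y ω) * ξ ω k) 2 P :=
  hfY.add (memLp_finsetSum _ fun k _ =>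
    memLp_mul_of_indepFun (hind.comp (hg k) (measurable_pi_apply k)) (hgY k) (hξ k))

/-- Itô's isometry for one time step: the noise `ξ` is centred, uncorrelated and independent of
the past `Y`, so the cross terms vanish. -/
lemma integral_sq_add_sum_noise [DecidableEq ι] {v : ℝ} (hind : IndepFun Y ξ P)
    (hf : Measurable f) (hg : ∀ k, Measurable (g k))
    (hfY : MemLp (fun ω => f (Y ω)) 2 P) (hgY : ∀ k, MemLp (fun ω => g k (Y ω)) 2 P)
    (hξ : ∀ k, MemLp (fun ω => ξ ω k) 2 P) (hmean : ∀ k, ∫ ω, ξ ω k ∂P = 0)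
    (hcov : ∀ k l, ∫ ω, ξ ω k * ξ ω l ∂P = if k = l then v else 0) :
    ∫ ω, (f (Y ω) + ∑ k, g k (Y ω) * ξ ω k) ^ 2 ∂P
      = ∫ ω, f (Y ω) ^ 2 ∂P + v * ∑ k, ∫ ω, g k (Y ω) ^ 2 ∂P := by
  have hi1 : ∀ k, IndepFun (fun ω => f (Y ω) * g k (Y ω)) (fun ω => ξ ω k) P := fun k =>
    hind.comp (hf.mul (hg k)) (measurable_pi_apply k)
  have hi2 : ∀ k l, IndepFun (fun ω => g k (Y ω) * g l (Y ω)) (fun ω => ξ ω k * ξ ω l) P :=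
    fun k l => hind.comp ((hg k).mul (hg l)) ((measurable_pi_apply k).mul (measurable_pi_apply l))
  have hfg : ∀ k, Integrable (fun ω => f (Y ω) * g k (Y ω)) P := fun k =>
    hfY.integrable_mul (hgY k)
  have hgg : ∀ k l, Integrable (fun ω => g k (Y ω) * g l (Y ω)) P := fun k l =>
    (hgY k).integrable_mul (hgY l)
  have hξξ : ∀ k l, Integrable (fun ω => ξ ω k * ξ ω l) P := fun k l =>
    (hξ k).integrable_mul (hξ l)
  have hint1 : ∀ k, Integrable (fun ω => f (Y ω) * (g k (Y ω) * ξ ω k)) P := fun k => by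
    refine (hfY.integrable_mul (memLp_mul_of_indepFun (hind.comp (hg k) (measurable_pi_apply k))
      (hgY k) (hξ k))).congr (ae_of_all _ fun ω => rfl)
  have hint2 : ∀ k l, Integrable (fun ω => g k (Y ω) * g l (Y ω) * (ξ ω k * ξ ω l)) P :=
    fun k l => (hi2 k l).integrable_mul (hgg k l) (hξξ k l)
  have hexp : ∀ ω, (f (Y ω) + ∑ k, g k (Y ω) * ξ ω k) ^ 2
      = f (Y ω) ^ 2 + 2 * ∑ k, f (Y ω) * (g k (Y ω) * ξ ω k)
        + ∑ k, ∑ l, g k (Y ω) * g l (Y ω) * (ξ ω k * ξ ω l) := fun ω => by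
    have h : ∑ k, ∑ l, g k (Y ω) * g l (Y ω) * (ξ ω k * ξ ω l)
        = (∑ k, g k (Y ω) * ξ ω k) * ∑ l, g l (Y ω) * ξ ω l := by
      rw [Finset.sum_mul_sum]
      exact Finset.sum_congr rfl fun k _ => Finset.sum_congr rfl fun l _ => by ring
    rw [h, ← Finset.mul_sum]
    ring
  have hs1 : Integrable (fun ω => ∑ k, f (Y ω) * (g k (Y ω) * ξ ω k)) P :=
    integrable_finsetSum _ fun k _ => hint1 k
  have hs2 : Integrable (fun ω => ∑ k, ∑ l, g k (Y ω) * g l (Y ω) * (ξ ω k * ξ ω l)) P :=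
    integrable_finsetSum _ fun k _ => integrable_finsetSum _ fun l _ => hint2 k l
  simp only [hexp]
  rw [integral_add (f := fun ω => f (Y ω) ^ 2 + 2 * ∑ k, f (Y ω) * (g k (Y ω) * ξ ω k))
    (hfY.integrable_sq.add (hs1.const_mul 2)) hs2,
    integral_add hfY.integrable_sq (hs1.const_mul 2), integral_const_mul,
    integral_finsetSum _ fun k _ => hint1 k,
    integral_finsetSum _ fun k _ => integrable_finsetSum _ fun l _ => hint2 k l]
  have hz : ∀ k, ∫ ω, f (Y ω) * (g k (Y ω) * ξ ω k) ∂P = 0 := fun k => by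
    simp only [← mul_assoc]
    rw [(hi1 k).integral_fun_mul_eq_mul_integral (hfg k).1 (hξ k).1, hmean, mul_zero]
  have hd : ∀ k, ∫ ω, ∑ l, g k (Y ω) * g l (Y ω) * (ξ ω k * ξ ω l) ∂P
      = v * ∫ ω, g k (Y ω) ^ 2 ∂P := fun k => by
    rw [integral_finsetSum _ fun l _ => hint2 k l, Finset.sum_eq_single k]
    · rw [(hi2 k k).integral_fun_mul_eq_mul_integral (hgg k k).1 (hξξ k k).1, hcov, if_pos rfl,
        mul_comm]
      simp only [pow_two]
    · intro l _ hl
      rw [(hi2 k l).integral_fun_mul_eq_mul_integral (hgg k l).1 (hξξ k l).1, hcov,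
        if_neg hl.symm, mul_zero]
    · simp
  simp only [hz, hd, Finset.sum_const_zero, mul_zero, add_zero, Finset.mul_sum]

end SecondMoment

/-! ### The solution as a functional of the noise -/

section Scheme

/-- The solution of the `θ`-scheme from the constant initial value `I₀`, driven by the values `x`
of the discretized noise. -/
noncomputable def schemeSolution (σ : ℝ → ℝ) (lam θ τ I₀ : ℝ) (n : ℕ) (x : ℕ → ZMod n → ℝ) :
    ℕ → ZMod n → ℝ
  | 0 => fun _ => I₀
  | i + 1 => resolvent n (θ * τ)
      (explicitStep n ((1 - θ) * τ) (schemeSolution σ lam θ τ I₀ n x i)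
        + fun k => lam * τ * σ (schemeSolution σ lam θ τ I₀ n x i k) * x i k)

variable {σ : ℝ → ℝ} {lam θ τ I₀ : ℝ} {n : ℕ}

/-- The solution at time `t_i` depends only on the noise before `t_i`. -/
lemma schemeSolution_congr {x y : ℕ → ZMod n → ℝ} {i : ℕ} (h : ∀ i' < i, x i' = y i') :
    schemeSolution σ lam θ τ I₀ n x i = schemeSolution σ lam θ τ I₀ n y i := by
  induction i with
  | zero => rfl
  | succ i ih =>
    simp only [schemeSolution, ih fun i' hi' => h i' (hi'.trans (Nat.lt_succ_self i)),
      h i (Nat.lt_succ_self i)]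

variable [NeZero n]

lemma measurable_schemeSolution (hσ : Measurable σ) (i : ℕ) :
    Measurable fun x : ℕ → ZMod n → ℝ => schemeSolution σ lam θ τ I₀ n x i := by
  have hlin : ∀ L : Module.End ℝ (ZMod n → ℝ), Measurable L := fun L =>
    L.continuous_of_finiteDimensional.measurable
  induction i with
  | zero => exact measurable_const
  | succ i ih =>
    refine (hlin _).comp (((hlin _).comp ih).add (measurable_pi_iff.2 fun k => ?_))
    refine (measurable_const.mul (hσ.comp ((measurable_pi_apply k).comp ih))).mul ?_
    exact (measurable_pi_apply k).comp (measurable_pi_apply i)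

lemma sum_mul_schemeSolution_succ (hθ : 0 ≤ θ * τ) (x : ℕ → ZMod n → ℝ) (i : ℕ)
    (w : ZMod n → ℝ) :
    ∑ k, w k * schemeSolution σ lam θ τ I₀ n x (i + 1) k
      = ∑ k, dualStep n (θ * τ) ((1 - θ) * τ) w k * schemeSolution σ lam θ τ I₀ n x i k
        + ∑ k, lam * τ * resolvent n (θ * τ) w k * σ (schemeSolution σ lam θ τ I₀ n x i k)
          * x i k := by
  rw [schemeSolution, sum_mul_resolvent hθ]
  simp only [Pi.add_apply, mul_add, Finset.sum_add_distrib]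
  rw [sum_mul_explicitStep]
  congr 1
  exact Finset.sum_congr rfl fun k _ => by ring

lemma eq_schemeSolution_of_isThetaScheme {Ω : Type*} [MeasurableSpace Ω] {P : Measure Ω}
    {W : Set (ℝ × ℝ) → Ω → ℝ} {u₀ : ℝ → ℝ} (hθ : 0 ≤ θ * τ)
    (hu₀ : ∀ x ∈ Icc (0 : ℝ) 1, u₀ x = I₀) {u : ℕ → ZMod n → Ω → ℝ}
    (hu : IsThetaScheme P W σ u₀ lam θ n τ u) :
    ∀ᵐ ω ∂P, ∀ i j, u i j ω
      = schemeSolution σ lam θ τ I₀ n (fun i j => discreteNoise W n τ i j ω) i j := by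
  filter_upwards [hu] with ω hω i
  have hn : (0 : ℝ) < n := Nat.cast_pos.2 (NeZero.pos n)
  induction i with
  | zero =>
    intro j
    rw [hω.1, schemeSolution, hu₀]
    have hj : (j.val : ℝ) ≤ n := by exact_mod_cast (ZMod.val_lt j).le
    exact ⟨by positivity, (div_le_one hn).2 hj⟩
  | succ i ih =>
    have hstep : (fun j => u (i + 1) j ω) = schemeSolution σ lam θ τ I₀ n
        (fun i j => discreteNoise W n τ i j ω) (i + 1) := by
      rw [schemeSolution, ← funext ih, ← resolvent_sub hθ fun j => u (i + 1) j ω]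
      congr 1
      ext j
      have h := hω.2 i j
      simp only [Pi.sub_apply, Pi.add_apply, Pi.smul_apply, smul_eq_mul, explicitStep_apply,
        gridLaplacian_apply]
      linear_combination h
    exact congrFun hstep

end Scheme

/-! ### Second moments of the solution -/

section Energy

variable {Ω : Type*} {W : Set (ℝ × ℝ) → Ω → ℝ} {σ : ℝ → ℝ} {n : ℕ} {lam θ τ I₀ : ℝ}

/-- The solution of the `θ`-scheme driven by the white noise `W`. -/
noncomputable def noiseSolution (W : Set (ℝ × ℝ) → Ω → ℝ) (σ : ℝ → ℝ) (lam θ τ I₀ : ℝ) (n : ℕ)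
    (i : ℕ) (ω : Ω) : ZMod n → ℝ :=
  schemeSolution σ lam θ τ I₀ n (fun i j => discreteNoise W n τ i j ω) i

variable [NeZero n]

lemma sum_mul_noiseSolution_succ (hθ : 0 ≤ θ * τ) (i : ℕ) (w : ZMod n → ℝ) (ω : Ω) :
    ∑ k, w k * noiseSolution W σ lam θ τ I₀ n (i + 1) ω k
      = ∑ k, dualStep n (θ * τ) ((1 - θ) * τ) w k * noiseSolution W σ lam θ τ I₀ n i ω k
        + ∑ k, lam * τ * resolvent n (θ * τ) w k * σ (noiseSolution W σ lam θ τ I₀ n i ω k)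
          * discreteNoise W n τ i k ω :=
  sum_mul_schemeSolution_succ hθ _ i w

variable [MeasurableSpace Ω] {P : Measure Ω}

lemma memLp_sum_mul {X : Ω → ZMod n → ℝ} (hX : ∀ k, MemLp (fun ω => X ω k) 2 P)
    (w : ZMod n → ℝ) : MemLp (fun ω => ∑ k, w k * X ω k) 2 P :=
  memLp_finsetSum _ fun k _ => (hX k).const_mul (w k)

variable [IsProbabilityMeasure P]

lemma memLp_comp_lipschitz {L : NNReal} (hσ : LipschitzWith L σ) {X : Ω → ℝ}
    (hX : MemLp X 2 P) : MemLp (fun ω => σ (X ω)) 2 P := by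
  have h0 : LipschitzWith L fun x => σ x - σ 0 := by
    simpa using hσ.sub (LipschitzWith.const (σ 0))
  have h1 := (h0.comp_memLp (sub_self _) hX).add (memLp_const (μ := P) (p := 2) (σ 0))
  refine h1.ae_eq (ae_of_all _ fun ω => ?_)
  simp

lemma indepFun_noiseSolution (hW : IsWhiteNoise P W) (hσ : Measurable σ) (hτ : 0 < τ) (i : ℕ) :
    IndepFun (noiseSolution W σ lam θ τ I₀ n i) (fun ω k => discreteNoise W n τ i k ω) P := by
  classical
  let G : ({p : ℕ × ZMod n // p.1 < i} → ℝ) → ℕ → ZMod n → ℝ := fun y i' k =>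
    if h : i' < i then y ⟨(i', k), h⟩ else 0
  have hG : Measurable G := by
    refine measurable_pi_iff.2 fun i' => measurable_pi_iff.2 fun k => ?_
    by_cases h : i' < i
    · simp only [G, h, dif_pos]
      exact measurable_pi_apply _
    · simp only [G, h, dif_neg, not_false_eq_true]
      exact measurable_const
  have h := (indepFun_discreteNoise (n := n) hW hτ i).comp
    ((measurable_schemeSolution (lam := lam) (θ := θ) (τ := τ) (I₀ := I₀) hσ i).comp hG)
    measurable_id
  refine h.congr (ae_of_all _ fun ω => ?_) (ae_of_all _ fun ω => rfl)
  symm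
  refine schemeSolution_congr fun i' hi' => ?_
  ext k
  simp [G, hi']

lemma memLp_noiseSolution (hW : IsWhiteNoise P W) {L : NNReal} (hσ : LipschitzWith L σ)
    (hθ : 0 ≤ θ * τ) (hτ : 0 < τ) (i : ℕ) (j : ZMod n) :
    MemLp (fun ω => noiseSolution W σ lam θ τ I₀ n i ω j) 2 P := by
  have hm := hσ.continuous.measurable
  have hg : ∀ (w : ZMod n → ℝ) k, Measurable fun y : ZMod n → ℝ =>
      lam * τ * resolvent n (θ * τ) w k * σ (y k) := fun w k =>
    measurable_const.mul (hm.comp (measurable_pi_apply k))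
  induction i generalizing j with
  | zero => exact memLp_const I₀
  | succ i ih =>
    have h := memLp_add_sum_noise (P := P) (indepFun_noiseSolution hW hm hτ i)
      (f := fun y => ∑ k, dualStep n (θ * τ) ((1 - θ) * τ) (Pi.single j 1) k * y k)
      (g := fun k y => lam * τ * resolvent n (θ * τ) (Pi.single j 1) k * σ (y k))
      (hg _)
      (memLp_sum_mul ih _) (fun k => (memLp_comp_lipschitz hσ (ih k)).const_mul _)
      (fun k => memLp_discreteNoise hW τ i k)
    refine h.ae_eq (ae_of_all _ fun ω => ?_)
    simp only [← sum_mul_noiseSolution_succ hθ]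
    simp [Pi.single_apply]

/-- The mild formulation in mean square: the second moment of the solution tested against `w` is
the contribution of the initial value plus the sum, over the noise injected `r + 1` steps before,
of the squared Green function times the second moment of `σ(u)`. -/
lemma integral_sq_noiseSolution (hW : IsWhiteNoise P W) {L : NNReal} (hσ : LipschitzWith L σ)
    (hθ : 0 ≤ θ * τ) (hτ : 0 < τ) (m : ℕ) (w : ZMod n → ℝ) :
    ∫ ω, (∑ k, w k * noiseSolution W σ lam θ τ I₀ n m ω k) ^ 2 ∂P
      = ((∑ k, w k) * I₀) ^ 2 + ∑ r ∈ Finset.range m, lam ^ 2 * τ * n * ∑ k,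
          resolvent n (θ * τ) ((dualStep n (θ * τ) ((1 - θ) * τ) ^ r) w) k ^ 2
            * ∫ ω, σ (noiseSolution W σ lam θ τ I₀ n (m - 1 - r) ω k) ^ 2 ∂P := by
  have hm := hσ.continuous.measurable
  have hg : ∀ (w : ZMod n → ℝ) k, Measurable fun y : ZMod n → ℝ =>
      lam * τ * resolvent n (θ * τ) w k * σ (y k) := fun w k =>
    measurable_const.mul (hm.comp (measurable_pi_apply k))
  induction m generalizing w with
  | zero =>
    simp [noiseSolution, schemeSolution, Finset.sum_mul]
  | succ m ih =>
    have hmem := memLp_noiseSolution (lam := lam) (I₀ := I₀) (n := n) hW hσ hθ hτ m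
    have h := integral_sq_add_sum_noise (P := P) (v := n / τ)
      (indepFun_noiseSolution (lam := lam) (θ := θ) (I₀ := I₀) hW hm hτ m)
      (f := fun y => ∑ k, dualStep n (θ * τ) ((1 - θ) * τ) w k * y k)
      (g := fun k y => lam * τ * resolvent n (θ * τ) w k * σ (y k))
      (Finset.measurable_sum _ fun k _ => measurable_const.mul (measurable_pi_apply k))
      (hg _)
      (memLp_sum_mul hmem _) (fun k => (memLp_comp_lipschitz hσ (hmem k)).const_mul _)
      (fun k => memLp_discreteNoise hW τ m k) (fun k => integral_discreteNoise hW τ m k)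
      (fun k l => by rw [integral_discreteNoise_mul hW hτ]; simp)
    simp only [sum_mul_noiseSolution_succ hθ]
    rw [h, ih, sum_dualStep hθ, Finset.sum_range_succ']
    simp only [mul_pow _ (σ _), integral_const_mul, pow_succ (dualStep n _ _),
      Module.End.mul_apply, pow_zero, Module.End.one_apply, Nat.add_sub_cancel, Nat.sub_zero]
    rw [add_assoc]
    congr 2
    · refine Finset.sum_congr rfl fun r _ => ?_
      rw [Nat.sub_sub, add_comm 1 r]
    · rw [Finset.mul_sum, Finset.mul_sum]
      refine Finset.sum_congr rfl fun k _ => ?_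
      field_simp

end Energy

/-! ### Exponential growth of the second moments -/

/-- A geometric sequence with ratio `ω (1 + p)` is a subsolution of the renewal equation with kernel
`p ω ^ (r + 1)`. -/
lemma pow_le_one_add_renewal_sum {ω p : ℝ} (hω0 : 0 ≤ ω) (hω1 : ω ≤ 1) (m : ℕ) :
    (ω * (1 + p)) ^ m
      ≤ 1 + p * ∑ r ∈ Finset.range m, ω ^ (r + 1) * (ω * (1 + p)) ^ (m - 1 - r) := by
  induction m with
  | zero => simp
  | succ m ih =>
    set κ := ω * (1 + p) with hκ
    have h : ∑ r ∈ Finset.range (m + 1), ω ^ (r + 1) * κ ^ (m + 1 - 1 - r)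
        = ω * ∑ r ∈ Finset.range m, ω ^ (r + 1) * κ ^ (m - 1 - r) + ω * κ ^ m := by
      rw [Finset.sum_range_succ', Finset.mul_sum]
      congr 1
      · refine Finset.sum_congr rfl fun r _ => ?_
        rw [Nat.add_sub_cancel, Nat.sub_sub, add_comm 1 r, pow_succ' ω (r + 1), mul_assoc]
      · simp
    rw [h, pow_succ]
    have h2 := mul_le_mul_of_nonneg_left ih hω0
    rw [hκ] at h2 ⊢
    linarith

section Growth

variable {Ω : Type*} [MeasurableSpace Ω] {P : Measure Ω} [IsProbabilityMeasure P]
  {W : Set (ℝ × ℝ) → Ω → ℝ} {σ : ℝ → ℝ} {n : ℕ} [NeZero n] {lam θ τ I₀ : ℝ}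

/-- For every number `2M + 1 ≤ n` of retained Fourier modes, the second moment grows at least
geometrically. -/
lemma pow_le_integral_sq_noiseSolution (hW : IsWhiteNoise P W) {L : NNReal}
    (hσ : LipschitzWith L σ) {J : ℝ} (hJ0 : 0 ≤ J) (hJ : ∀ y, J * |y| ≤ |σ y|)
    (hθ0 : 0 ≤ θ) (hθ1 : θ ≤ 1) (hτ : 0 < τ) (M : ℕ) (hM : 2 * M + 1 ≤ n)
    (hx : 4 * Real.pi ^ 2 * (M : ℝ) ^ 2 * τ ≤ 1) (m : ℕ) (j : ZMod n) :
    I₀ ^ 2 * ((1 - 4 * Real.pi ^ 2 * (M : ℝ) ^ 2 * τ) ^ 2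
        * (1 + lam ^ 2 * J ^ 2 * τ * (2 * M + 1))) ^ m
      ≤ ∫ ω, noiseSolution W σ lam θ τ I₀ n m ω j ^ 2 ∂P := by
  have hθ : 0 ≤ θ * τ := mul_nonneg hθ0 hτ.le
  set x := 4 * Real.pi ^ 2 * (M : ℝ) ^ 2 * τ with hxdef
  have hx0 : 0 ≤ x := by positivity
  set p := lam ^ 2 * J ^ 2 * τ * (2 * M + 1) with hp
  have hp0 : 0 ≤ p := by positivity
  set κ := (1 - x) ^ 2 * (1 + p) with hκ
  have hκ0 : 0 ≤ κ := by positivity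
  induction m using Nat.strong_induction_on generalizing j with
  | _ m ih =>
    have hrep := integral_sq_noiseSolution (P := P) (lam := lam) (I₀ := I₀) hW hσ hθ hτ m
      (Pi.single j 1)
    have hsingle : ∀ y : ZMod n → ℝ, ∑ k, (Pi.single j 1 : ZMod n → ℝ) k * y k = y j := fun y => by
      simp [Pi.single_apply]
    simp only [hsingle, Finset.sum_pi_single', Finset.mem_univ, if_true, one_mul] at hrep
    rw [hrep]
    have hterm : ∀ r ∈ Finset.range m, I₀ ^ 2 * (p * (((1 - x) ^ 2) ^ (r + 1) * κ ^ (m - 1 - r)))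
        ≤ lam ^ 2 * τ * n * ∑ k,
          resolvent n (θ * τ) ((dualStep n (θ * τ) ((1 - θ) * τ) ^ r) (Pi.single j 1)) k ^ 2
            * ∫ ω, σ (noiseSolution W σ lam θ τ I₀ n (m - 1 - r) ω k) ^ 2 ∂P := by
      intro r hr
      have hr' : m - 1 - r < m := by have := Finset.mem_range.1 hr; omega
      have hσ2 : ∀ k, J ^ 2 * (I₀ ^ 2 * κ ^ (m - 1 - r))
          ≤ ∫ ω, σ (noiseSolution W σ lam θ τ I₀ n (m - 1 - r) ω k) ^ 2 ∂P := fun k => by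
        have hmem := memLp_noiseSolution (P := P) (lam := lam) (I₀ := I₀) hW hσ hθ hτ
          (m - 1 - r) k
        calc J ^ 2 * (I₀ ^ 2 * κ ^ (m - 1 - r))
            ≤ J ^ 2 * ∫ ω, noiseSolution W σ lam θ τ I₀ n (m - 1 - r) ω k ^ 2 ∂P := by
              gcongr
              exact ih _ hr' k
          _ = ∫ ω, J ^ 2 * noiseSolution W σ lam θ τ I₀ n (m - 1 - r) ω k ^ 2 ∂P :=
              (integral_const_mul _ _).symm
          _ ≤ _ := by
              refine integral_mono (hmem.integrable_sq.const_mul _)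
                (memLp_comp_lipschitz hσ hmem).integrable_sq fun ω => ?_
              have h := hJ (noiseSolution W σ lam θ τ I₀ n (m - 1 - r) ω k)
              calc _ = (J * |noiseSolution W σ lam θ τ I₀ n (m - 1 - r) ω k|) ^ 2 := by
                    rw [mul_pow, sq_abs]
                _ ≤ |σ (noiseSolution W σ lam θ τ I₀ n (m - 1 - r) ω k)| ^ 2 := by gcongr
                _ = _ := sq_abs _
      have hker := le_sum_sq_kernel (n := n) hθ0 hθ1 hτ.le M hM hx r j
      rw [← hxdef] at hker
      calc I₀ ^ 2 * (p * (((1 - x) ^ 2) ^ (r + 1) * κ ^ (m - 1 - r)))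
          = lam ^ 2 * τ * (J ^ 2 * (I₀ ^ 2 * κ ^ (m - 1 - r)))
              * ((2 * M + 1) * ((1 - x) ^ 2) ^ (r + 1)) := by rw [hp]; ring
        _ ≤ lam ^ 2 * τ * (J ^ 2 * (I₀ ^ 2 * κ ^ (m - 1 - r))) * (n * ∑ k, resolvent n (θ * τ)
              ((dualStep n (θ * τ) ((1 - θ) * τ) ^ r) (Pi.single j 1)) k ^ 2) := by gcongr
        _ = lam ^ 2 * τ * n * ∑ k, resolvent n (θ * τ)
              ((dualStep n (θ * τ) ((1 - θ) * τ) ^ r) (Pi.single j 1)) k ^ 2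
              * (J ^ 2 * (I₀ ^ 2 * κ ^ (m - 1 - r))) := by rw [← Finset.sum_mul]; ring
        _ ≤ _ := by
            gcongr with k
            exact hσ2 k
    calc I₀ ^ 2 * κ ^ m
        ≤ I₀ ^ 2 * (1 + p * ∑ r ∈ Finset.range m,
            ((1 - x) ^ 2) ^ (r + 1) * κ ^ (m - 1 - r)) := by
          gcongr
          exact pow_le_one_add_renewal_sum (sq_nonneg _)
            (pow_le_one₀ (by linarith) (by linarith)) m
      _ = I₀ ^ 2 + ∑ r ∈ Finset.range m,
            I₀ ^ 2 * (p * (((1 - x) ^ 2) ^ (r + 1) * κ ^ (m - 1 - r))) := by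
          rw [← Finset.mul_sum, ← Finset.mul_sum]; ring
      _ ≤ _ := by
          exact add_le_add_right (Finset.sum_le_sum hterm) _

end Growth

/-! ### The choice of the number of Fourier modes -/

/-- If `M` is the integer part of `z / (4π)` and `z ^ 2 τ` is small, then the geometric ratio
obtained from `2M + 1` Fourier modes is at least `exp (z ^ 2 τ)`. -/
lemma exp_le_growth_factor {z τ p : ℝ} {M : ℕ} (hτ : 0 < τ)
    (hM : (M : ℝ) * (4 * Real.pi) ≤ z) (hM' : z ≤ (M + 1) * (4 * Real.pi))
    (hz : z ^ 2 * τ ≤ Real.pi / 64) (hp : 16 * z * τ * (2 * M + 1) ≤ p) :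
    4 * Real.pi ^ 2 * (M : ℝ) ^ 2 * τ ≤ 1 ∧
      Real.exp (z ^ 2 * τ) ≤ (1 - 4 * Real.pi ^ 2 * (M : ℝ) ^ 2 * τ) ^ 2 * (1 + p) := by
  have hπ := Real.pi_pos
  have hπ' := Real.pi_lt_d2
  have hM0 : (0 : ℝ) ≤ M := Nat.cast_nonneg M
  have hz0 : 0 ≤ z := le_trans (by positivity) hM
  set x := 4 * Real.pi ^ 2 * (M : ℝ) ^ 2 * τ with hx
  set δ := z ^ 2 * τ with hδ
  have hδ0 : 0 ≤ δ := by positivity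
  have hx0 : 0 ≤ x := by positivity
  have hx4 : 4 * x ≤ δ := by
    have h : (M * (4 * Real.pi)) ^ 2 ≤ z ^ 2 := by gcongr
    calc 4 * x = (M * (4 * Real.pi)) ^ 2 * τ := by rw [hx]; ring
      _ ≤ δ := by rw [hδ]; gcongr
  have hmodes : z ^ 2 + 8 * Real.pi ^ 2 * (M : ℝ) ^ 2 ≤ 4 * Real.pi * z * (2 * M + 1) := by
    have h1 := mul_le_mul_of_nonneg_left hM' hz0
    have h2 := mul_le_mul_of_nonneg_left hM (mul_nonneg hπ.le hM0)
    nlinarith [mul_nonneg (mul_nonneg hπ.le hM0) hz0]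
  have hE : δ + 2 * x ≤ Real.pi / 4 * p := by
    calc δ + 2 * x = (z ^ 2 + 8 * Real.pi ^ 2 * (M : ℝ) ^ 2) * τ := by rw [hx, hδ]; ring
      _ ≤ 4 * Real.pi * z * (2 * M + 1) * τ := by gcongr
      _ = Real.pi / 4 * (16 * z * τ * (2 * M + 1)) := by ring
      _ ≤ Real.pi / 4 * p := by gcongr
  have hp0 : 0 ≤ p := le_trans (by positivity) hp
  refine ⟨by linarith, ?_⟩
  have hexp : Real.exp δ * (1 - δ) ≤ 1 := by
    calc Real.exp δ * (1 - δ) ≤ Real.exp δ * Real.exp (-δ) := by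
          gcongr
          exact Real.one_sub_le_exp_neg δ
      _ = 1 := by rw [← Real.exp_add, add_neg_cancel, Real.exp_zero]
  have hδ1 : 0 < 1 - δ := by linarith
  have hmain : 1 ≤ (1 - x) ^ 2 * (1 + p) * (1 - δ) := by
    have h1 : 1 - (δ + 2 * x) ≤ (1 - x) ^ 2 * (1 - δ) := by nlinarith [mul_nonneg hx0 hδ0]
    have h2 : 1 ≤ (1 - (δ + 2 * x)) * (1 + p) := by
      have h3 : δ + 2 * x ≤ 0.1 := by linarith
      have h4 : δ + 2 * x ≤ 0.79 * p := by nlinarith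
      nlinarith
    nlinarith [mul_le_mul_of_nonneg_right h1 (by linarith : (0 : ℝ) ≤ 1 + p)]
  refine le_of_mul_le_mul_right (hexp.trans hmain) hδ1

lemma interpolate_kappa {n : ℕ} [NeZero n] (v : ZMod n → ℝ) (x : ℝ) :
    interpolate n v (kappa n x) = v (⌊(n : ℝ) * x⌋ : ℤ) := by
  have hn : (n : ℝ) ≠ 0 := Nat.cast_ne_zero.2 (NeZero.ne n)
  have h : ⌊(n : ℝ) * kappa n x⌋ = ⌊(n : ℝ) * x⌋ := by
    rw [kappa, mul_div_cancel₀ _ hn, Int.floor_intCast]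
  have h2 : kappa n (kappa n x) = kappa n x := by
    conv_lhs => rw [kappa, h]
    rfl
  rw [interpolate, h2, h, sub_self, mul_zero, zero_mul, add_zero]

lemma J0_mul_abs_le (σ : ℝ → ℝ) (y : ℝ) : J0 σ * |y| ≤ |σ y| := by
  rcases eq_or_ne y 0 with rfl | hy
  · simp
  · have h : J0 σ ≤ |σ y / y| :=
      ciInf_le ⟨0, by rintro _ ⟨x, rfl⟩; exact abs_nonneg _⟩ (⟨y, hy⟩ : {x : ℝ // x ≠ 0})
    rwa [abs_div, le_div_iff₀ (abs_pos.2 hy)] at h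

end StochHeat

theorem mainTheorem5 (n : ℕ) (hn : 3 ≤ n) (τ : ℝ) (hτ : 0 < τ) (hτ1 : τ < 1) :
    ∃ T : ℝ, 0 < T ∧
      ∀ (θ : ℝ), 0 ≤ θ → θ ≤ 1 →
      ∀ (lam : ℝ), 0 < lam →
      ∀ (ζ : ℝ), 0 < ζ → ζ * lam ^ 2 ≤ n →
      ∀ (σ : ℝ → ℝ), (∃ L, LipschitzWith L σ) → 0 < StochHeat.J0 σ →
      StochHeat.J0 σ ^ 4 * (n : ℝ) ^ 2 * τ / (16 * Real.pi * ζ ^ 2)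
        + 16 * Real.pi * (n : ℝ) ^ 2 * τ < 1 →
      ∀ (I₀ : ℝ), 0 < I₀ →
      ∀ (u₀ : ℝ → ℝ), (∀ x ∈ Set.Icc (0 : ℝ) 1, u₀ x = I₀) →
      ∀ (Ω : Type*) [MeasurableSpace Ω] (P : MeasureTheory.Measure Ω)
        [MeasureTheory.IsProbabilityMeasure P]
        (W : Set (ℝ × ℝ) → Ω → ℝ), StochHeat.IsWhiteNoise P W →
      ∀ (u : ℕ → ZMod n → Ω → ℝ), StochHeat.IsThetaScheme P W σ u₀ lam θ n τ u →
      ∀ (m : ℕ), T < m * τ →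
        16 * Real.pi * ζ * I₀ ^ 2 / (StochHeat.J0 σ ^ 2 + 32 * Real.pi * ζ)
            * Real.exp (4 * Real.pi ^ 2 * ζ ^ 2 / (StochHeat.J0 σ ^ 2 + 32 * Real.pi * ζ) ^ 2
                * StochHeat.J0 σ ^ 4 * lam ^ 4 * (m * τ))
          ≤ ⨅ x : Set.Icc (0 : ℝ) 1,
              ∫ ω, |StochHeat.interpolate n (fun j => u m j ω) (StochHeat.kappa n x)| ^ 2 ∂P := by
  -- the bound holds at every time step, so that any threshold will do
  refine ⟨1, one_pos, ?_⟩
  intro θ hθ0 hθ1 lam hlam ζ hζ hζn σ ⟨L, hσ⟩ hJ hcfl I₀ _ u₀ hu₀ Ω _ P _ W hW u hu m _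
  have : NeZero n := ⟨by omega⟩
  have hn0 : (0 : ℝ) < n := Nat.cast_pos.2 (NeZero.pos n)
  have hπ := Real.pi_pos
  set J := StochHeat.J0 σ with hJdef
  set D := J ^ 2 + 32 * Real.pi * ζ with hD
  have hD0 : 0 < D := by positivity
  -- the growth rate in the statement is `z ^ 2`
  set z := 2 * Real.pi * ζ * lam ^ 2 * J ^ 2 / D with hz
  have hz0 : 0 < z := by positivity
  have hzD : z * D = 2 * Real.pi * (ζ * lam ^ 2) * J ^ 2 := by rw [hz]; field_simp
  have hzn : z < 2 * Real.pi * n := by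
    have h1 : z * D ≤ 2 * Real.pi * n * J ^ 2 := by rw [hzD]; gcongr
    have h2 : 2 * Real.pi * n * J ^ 2 < 2 * Real.pi * n * D := by
      gcongr
      rw [hD]
      linarith [mul_pos hπ hζ]
    exact lt_of_mul_lt_mul_right (h1.trans_lt h2) hD0.le
  have hz16 : 16 * z ≤ lam ^ 2 * J ^ 2 := by
    rw [hz, mul_div_assoc', div_le_iff₀ hD0, hD]
    nlinarith [mul_nonneg (sq_nonneg lam) (sq_nonneg (J ^ 2)),
      mul_nonneg (sq_nonneg lam) (sq_nonneg J)]
  have hzτ : z ^ 2 * τ ≤ Real.pi / 64 := by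
    -- the stability condition and two applications of the inequality of the means
    have h1 : (n : ℝ) ^ 2 * τ * J ^ 2 / ζ ≤ 1 / 2 := by
      have hsq : 2 * ((n : ℝ) ^ 2 * τ * J ^ 2 / ζ)
          ≤ J ^ 4 * (n : ℝ) ^ 2 * τ / (16 * Real.pi * ζ ^ 2) + 16 * Real.pi * (n : ℝ) ^ 2 * τ := by
        have h : 0 ≤ (n : ℝ) ^ 2 * τ * (J ^ 2 - 16 * Real.pi * ζ) ^ 2 / (16 * Real.pi * ζ ^ 2) := by
          positivity
        have e : (n : ℝ) ^ 2 * τ * (J ^ 2 - 16 * Real.pi * ζ) ^ 2 / (16 * Real.pi * ζ ^ 2)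
            = J ^ 4 * (n : ℝ) ^ 2 * τ / (16 * Real.pi * ζ ^ 2) + 16 * Real.pi * (n : ℝ) ^ 2 * τ
              - 2 * ((n : ℝ) ^ 2 * τ * J ^ 2 / ζ) := by
          field_simp
          ring
        linarith
      linarith
    have h2 : z ^ 2 * D ^ 2 ≤ 4 * Real.pi ^ 2 * (n : ℝ) ^ 2 * J ^ 4 := by
      calc z ^ 2 * D ^ 2 = (2 * Real.pi * (ζ * lam ^ 2) * J ^ 2) ^ 2 := by rw [← hzD]; ring
        _ ≤ (2 * Real.pi * n * J ^ 2) ^ 2 := by gcongr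
        _ = _ := by ring
    have h3 : 4 * J ^ 2 * (32 * Real.pi * ζ) ≤ D ^ 2 := by
      rw [hD]; nlinarith [sq_nonneg (J ^ 2 - 32 * Real.pi * ζ)]
    have h4 : z ^ 2 * (4 * J ^ 2 * (32 * Real.pi * ζ)) ≤ 4 * Real.pi ^ 2 * (n : ℝ) ^ 2 * J ^ 4 :=
      le_trans (by gcongr) h2
    have h5 : z ^ 2 ≤ Real.pi / 32 * ((n : ℝ) ^ 2 * J ^ 2 / ζ) := by
      have hc : 0 < 4 * J ^ 2 * (32 * Real.pi * ζ) := by positivity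
      refine le_of_mul_le_mul_right (h4.trans (le_of_eq ?_)) hc
      field_simp
    calc z ^ 2 * τ ≤ Real.pi / 32 * ((n : ℝ) ^ 2 * J ^ 2 / ζ) * τ := by gcongr
      _ = Real.pi / 32 * ((n : ℝ) ^ 2 * τ * J ^ 2 / ζ) := by ring
      _ ≤ Real.pi / 32 * (1 / 2) := by gcongr
      _ = Real.pi / 64 := by ring
  -- the frequencies `|l| ≤ z / (4π)` are the ones that drive the growth
  set M := ⌊z / (4 * Real.pi)⌋₊ with hMdef
  have hM : (M : ℝ) * (4 * Real.pi) ≤ z :=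
    (le_div_iff₀ (by positivity)).1 (Nat.floor_le (by positivity))
  have hM' : z ≤ (M + 1) * (4 * Real.pi) :=
    ((div_lt_iff₀ (by positivity)).1 (Nat.lt_floor_add_one _)).le
  have hMn : 2 * M + 1 ≤ n := by
    have h : (2 * M : ℝ) < n := by
      have h1 := hM.trans_lt hzn
      nlinarith
    exact_mod_cast h
  have hp : 16 * z * τ * (2 * M + 1) ≤ lam ^ 2 * J ^ 2 * τ * (2 * M + 1) := by gcongr
  obtain ⟨hx, hgrowth⟩ := StochHeat.exp_le_growth_factor hτ hM hM' hzτ hp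
  have hθ : 0 ≤ θ * τ := mul_nonneg hθ0 hτ.le
  have : Nonempty (Set.Icc (0 : ℝ) 1) := ⟨⟨0, by simp⟩⟩
  refine le_ciInf fun x => ?_
  have hint : ∫ ω, |StochHeat.interpolate n (fun j => u m j ω) (StochHeat.kappa n x)| ^ 2 ∂P
      = ∫ ω, StochHeat.noiseSolution W σ lam θ τ I₀ n m ω (⌊(n : ℝ) * x⌋ : ℤ) ^ 2 ∂P := by
    refine integral_congr_ae ?_
    filter_upwards [StochHeat.eq_schemeSolution_of_isThetaScheme hθ hu₀ hu] with ω hω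
    rw [StochHeat.interpolate_kappa, sq_abs, hω]
    rfl
  rw [hint]
  have hrate : 4 * Real.pi ^ 2 * ζ ^ 2 / D ^ 2 * J ^ 4 * lam ^ 4 * (m * τ) = m * (z ^ 2 * τ) := by
    rw [hz, div_pow]; ring
  have hC : 16 * Real.pi * ζ * I₀ ^ 2 / D ≤ I₀ ^ 2 := by
    rw [div_le_iff₀ hD0, hD]
    nlinarith [mul_nonneg (mul_nonneg hπ.le hζ.le) (sq_nonneg I₀),
      mul_nonneg (sq_nonneg J) (sq_nonneg I₀)]
  refine le_trans ?_ (StochHeat.pow_le_integral_sq_noiseSolution hW hσ hJ.le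
    (StochHeat.J0_mul_abs_le σ) hθ0 hθ1 hτ M hMn hx m _)
  rw [hrate, Real.exp_nat_mul]
  gcongr
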